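/- Write $\log$ for the binary logarithm. For every real $\epsilon>0$ there is a constant $c$, depending only on $\epsilon$, such that the following holds for all natural numbers $n$ and $b$ with $c \le b \le 0.7\log n$. For every $2$-coloring $G$ of the edges of the complete graph on $n$ vertices there is a natural number $k$ (which may depend on $G$) with $$\frac{3}{7}\,b < k < b$$ such that $G$ contains at least $$\frac{n^k}{2^{(1+\epsilon)k^2}}$$ monochromatic complete subgraphs of size $k$, that is, sets of $k$ vertices all of whose pairs have the same color. -/

import Mathlib

/-- The number of monochromatic complete subgraphs of size `k` in a 2-coloring `C` of the edges of
the complete graph on `V`: the number of `k`-element vertex sets all of whose pairs receive the same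
color. -/
noncomputable def numMonoCliques {V : Type*} (C : SimpleGraph.TopEdgeLabeling V (Fin 2))
    (k : ℕ) : ℕ :=
  Set.ncard {s : Finset V | ∃ i : Fin 2, (C.labelGraph i).IsNClique k s}

/-! Run a Ramsey-type process for `m = ⌊10b/7⌋` steps: pick a vertex of the current set, then keep
half of the set, joined to it in one colour. There are `∏ ⌊n/2^t⌋` runs, and by pigeonhole a
`2^{-m}` fraction share one colour pattern `w`. For a set `T` of `k` positions of one colour in `w`,
the vertices picked at `T` form a clique. A run is recovered from its vertices on `T` and its
indices off `T`, so each clique arises from at most `k^k ∏_{t ∉ T} ⌊n/2^t⌋` runs. Any `T` with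
position sum at most `k²` thus gives `n^k / 2^{k² + O(k log k)}` cliques. -/

open Finset in
/-- In a 2-coloured complete graph, every vertex `v` of `S` is joined in a single colour to a subset
of `S` of size `⌊|S| / 2⌋`. -/
theorem exists_half_subset_labelGraph_adj {V : Type*} (C : SimpleGraph.TopEdgeLabeling V (Fin 2))
    (S : Finset V) (v : V) (hv : v ∈ S) :
    ∃ c : Fin 2, ∃ S' : Finset V, S' ⊆ S ∧ S'.card = S.card / 2 ∧
      ∀ u ∈ S', (C.labelGraph c).Adj v u := by
  classical
  have key : ∃ c : Fin 2, S.card / 2 ≤ (S.filter fun u => (C.labelGraph c).Adj v u).card := by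
    by_contra! h
    have hsub : S.erase v ⊆ (S.filter fun u => (C.labelGraph 0).Adj v u) ∪
        (S.filter fun u => (C.labelGraph 1).Adj v u) := by
      intro u hu
      rw [mem_erase] at hu
      have hne : v ≠ u := fun e => hu.1 e.symm
      have h2 : ∀ x : Fin 2, x = 0 ∨ x = 1 := by decide
      rw [mem_union, mem_filter, mem_filter, SimpleGraph.TopEdgeLabeling.labelGraph_adj,
        SimpleGraph.TopEdgeLabeling.labelGraph_adj]
      rcases h2 (C.get v u hne) with h' | h'
      · exact Or.inl ⟨hu.2, hne, h'⟩
      · exact Or.inr ⟨hu.2, hne, h'⟩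
    have h1 := (card_le_card hsub).trans (card_union_le _ _)
    rw [card_erase_of_mem hv] at h1
    have := h 0
    have := h 1
    omega
  obtain ⟨c, hc⟩ := key
  obtain ⟨S', hS', hcard⟩ := exists_subset_card_eq hc
  exact ⟨c, S', hS'.trans (filter_subset _ _), hcard, fun u hu => (mem_filter.1 (hS' hu)).2⟩

/-! ### The halving process -/

/-- The set of surviving vertices after `t` steps of the process which, from the current set `S`,
chooses the vertex of index `a t` in the enumeration `e S` and passes to `nxt S v`. -/
def survivors {V : Type*} (nxt : Finset V → V → Finset V) (e : Finset V → ℕ → V) (S : Finset V)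
    (a : ℕ → ℕ) : ℕ → Finset V
  | 0 => S
  | t + 1 => nxt (survivors nxt e S a t) (e (survivors nxt e S a t) (a t))

section Survivors

variable {V : Type*} {nxt : Finset V → V → Finset V} {e : Finset V → ℕ → V} {S : Finset V}

theorem card_survivors (hcard : ∀ S, ∀ v ∈ S, (nxt S v).card = S.card / 2)
    (he : ∀ S : Finset V, ∀ i < S.card, e S i ∈ S) {a : ℕ → ℕ} {t : ℕ}
    (ha : ∀ s < t, a s < S.card / 2 ^ s) :
    (survivors nxt e S a t).card = S.card / 2 ^ t := by
  induction t with
  | zero => simp [survivors]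
  | succ t ih =>
    have ih' := ih fun s hs => ha s (hs.trans (Nat.lt_succ_self t))
    rw [survivors, hcard _ _ (he _ _ (by rw [ih']; exact ha t (Nat.lt_succ_self t))), ih',
      Nat.div_div_eq_div_mul, pow_succ]

theorem survivors_vertex_mem (hcard : ∀ S, ∀ v ∈ S, (nxt S v).card = S.card / 2)
    (he : ∀ S : Finset V, ∀ i < S.card, e S i ∈ S) {a : ℕ → ℕ} {t : ℕ}
    (ha : ∀ s < t + 1, a s < S.card / 2 ^ s) :
    e (survivors nxt e S a t) (a t) ∈ survivors nxt e S a t := by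
  refine he _ _ ?_
  rw [card_survivors hcard he fun s hs => ha s (hs.trans (Nat.lt_succ_self t))]
  exact ha t (Nat.lt_succ_self t)

theorem survivors_subset (hsub : ∀ S, ∀ v ∈ S, nxt S v ⊆ S)
    (hcard : ∀ S, ∀ v ∈ S, (nxt S v).card = S.card / 2)
    (he : ∀ S : Finset V, ∀ i < S.card, e S i ∈ S) {a : ℕ → ℕ} {s t : ℕ} (hst : s ≤ t)
    (ha : ∀ s < t, a s < S.card / 2 ^ s) :
    survivors nxt e S a t ⊆ survivors nxt e S a s := by
  induction t, hst using Nat.le_induction with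
  | base => exact Finset.Subset.refl _
  | succ t hst ih =>
    exact (hsub _ _ (survivors_vertex_mem hcard he ha)).trans
      (ih fun s hs => ha s (hs.trans (Nat.lt_succ_self t)))

/-- Two runs of the process with the same vertices at the steps in `T` and the same indices at the
other steps coincide. -/
theorem survivors_code_unique (hcard : ∀ S, ∀ v ∈ S, (nxt S v).card = S.card / 2)
    (he : ∀ S : Finset V, ∀ i < S.card, e S i ∈ S)
    (hinj : ∀ S : Finset V, ∀ i < S.card, ∀ j < S.card, e S i = e S j → i = j)
    {a a' : ℕ → ℕ} {m : ℕ} (ha : ∀ s < m, a s < S.card / 2 ^ s)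
    (ha' : ∀ s < m, a' s < S.card / 2 ^ s)
    (h : ∀ s < m, a s = a' s ∨
      e (survivors nxt e S a s) (a s) = e (survivors nxt e S a' s) (a' s)) {t : ℕ} (ht : t ≤ m) :
    survivors nxt e S a t = survivors nxt e S a' t ∧ ∀ s < t, a s = a' s := by
  induction t with
  | zero => exact ⟨rfl, by simp⟩
  | succ t ih =>
    obtain ⟨h1, h2⟩ := ih (by omega)
    have hc := card_survivors hcard he (a := a') (t := t) fun s hs => ha' s (by omega)
    have hat : a t = a' t := by
      rcases h t (by omega) with h | h
      · exact h
      · rw [h1] at h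
        exact hinj _ _ (by rw [hc]; exact ha t (by omega)) _
          (by rw [hc]; exact ha' t (by omega)) h
    refine ⟨by rw [survivors, survivors, h1, hat], fun s hs => ?_⟩
    rcases Nat.lt_succ_iff_lt_or_eq.1 hs with hs | rfl
    · exact h2 s hs
    · exact hat

end Survivors

theorem exists_enumeration (V : Type*) [Nonempty V] : ∃ e : Finset V → ℕ → V,
    (∀ S : Finset V, ∀ i < S.card, e S i ∈ S) ∧
      ∀ S : Finset V, ∀ i < S.card, ∀ j < S.card, e S i = e S j → i = j := by
  classical
  refine ⟨fun S i => if h : i < S.card then (S.equivFin.symm ⟨i, h⟩ : V) else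
    Classical.arbitrary V, fun S i hi => ?_, fun S i hi j hj h => ?_⟩
  · simp only [hi, dif_pos]
    exact (S.equivFin.symm ⟨i, hi⟩).2
  · simp only [hi, hj, dif_pos] at h
    simpa using S.equivFin.symm.injective (Subtype.ext h)

/-! ### Counting runs with a common colour pattern -/

open Finset in
/-- There is a colour pattern `w` of length `m` such that every set `T` of positions of a single
colour yields many monochromatic cliques of size `|T|`. -/
theorem exists_pattern_prod_le_numMonoCliques {n m : ℕ} (hm : 2 ^ m ≤ n)
    (C : SimpleGraph.TopEdgeLabeling (Fin n) (Fin 2)) :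
    ∃ w : Fin m → Fin 2, ∀ (i : Fin 2) (T : Finset (Fin m)), (∀ t ∈ T, w t = i) →
      ∏ t ∈ T, (n / 2 ^ (t : ℕ)) ≤ 2 ^ m * (T.card ^ T.card * numMonoCliques C T.card) := by
  classical
  have hn : 0 < n := (pow_pos two_pos m).trans_le hm
  have hx : ∀ t : Fin m, 0 < n / 2 ^ (t : ℕ) := fun t =>
    Nat.div_pos ((Nat.pow_le_pow_right two_pos t.2.le).trans hm) (by positivity)
  have : Nonempty (Fin n) := ⟨⟨0, hn⟩⟩
  obtain ⟨e, he, hinj⟩ := exists_enumeration (Fin n)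
  have hex : ∀ (S : Finset (Fin n)) (v : Fin n), ∃ c : Fin 2, ∃ S' : Finset (Fin n), v ∈ S →
      S' ⊆ S ∧ S'.card = S.card / 2 ∧ ∀ u ∈ S', (C.labelGraph c).Adj v u := by
    intro S v
    by_cases hv : v ∈ S
    · obtain ⟨c, S', h⟩ := exists_half_subset_labelGraph_adj C S v hv
      exact ⟨c, S', fun _ => h⟩
    · exact ⟨0, ∅, fun h => absurd h hv⟩
  choose col nxt hprop using hex
  have hsub : ∀ S, ∀ v ∈ S, nxt S v ⊆ S := fun S v hv => (hprop S v hv).1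
  have hcard : ∀ S, ∀ v ∈ S, (nxt S v).card = S.card / 2 := fun S v hv => (hprop S v hv).2.1
  -- The padding value 0 is never read in the first `m` steps.
  let ext : (Fin m → ℕ) → ℕ → ℕ := fun a t => if h : t < m then a ⟨t, h⟩ else 0
  have hext : ∀ a (t : Fin m), ext a t = a t := fun a t => by simp [ext]
  let st : (Fin m → ℕ) → ℕ → Finset (Fin n) := fun a => survivors nxt e univ (ext a)
  let vtx : (Fin m → ℕ) → Fin m → Fin n := fun a t => e (st a t) (a t)
  let A : Finset (Fin m → ℕ) := Fintype.piFinset fun t => range (n / 2 ^ (t : ℕ))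
  have hA : ∀ a ∈ A, ∀ s < m, ext a s < (univ : Finset (Fin n)).card / 2 ^ s := by
    intro a ha s hs
    have := mem_range.1 (Fintype.mem_piFinset.1 ha ⟨s, hs⟩)
    rw [card_univ, Fintype.card_fin]
    simpa [ext, hs] using this
  have hAcard : A.card = ∏ t : Fin m, (n / 2 ^ (t : ℕ)) := by
    simp [A, Fintype.card_piFinset]
  obtain ⟨w, -, hw⟩ := exists_le_card_fiber_of_nsmul_le_card_of_maps_to (s := A)
    (t := (univ : Finset (Fin m → Fin 2))) (f := fun a (t : Fin m) => col (st a t) (vtx a t))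
    (b := (A.card : ℝ) / 2 ^ m) (fun _ _ => mem_univ _) univ_nonempty
    (by simp only [card_univ, Fintype.card_fun, Fintype.card_fin, nsmul_eq_mul]
        push_cast
        rw [mul_div_cancel₀ _ (by positivity)])
  refine ⟨w, fun i T hT => ?_⟩
  set F := A.filter fun a => (fun t : Fin m => col (st a t) (vtx a t)) = w with hF
  let K : Finset (Finset (Fin n)) :=
    univ.filter fun s => ∃ i : Fin 2, (C.labelGraph i).IsNClique T.card s
  have hK : K.card = numMonoCliques C T.card := by
    rw [numMonoCliques, ← Set.ncard_coe_finset]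
    congr 1
    ext s
    simp [K]
  have hadj : ∀ a ∈ F, ∀ s t : Fin m, s < t → w s = i →
      (C.labelGraph i).Adj (vtx a s) (vtx a t) := by
    intro a ha s t hst hs
    obtain ⟨haA, haw⟩ := mem_filter.1 ha
    have hmem : ∀ t : Fin m, vtx a t ∈ st a t := fun t => by
      have := survivors_vertex_mem (nxt := nxt) hcard he (t := t) (a := ext a) (S := univ)
        fun s hs => hA a haA s (by omega)
      rwa [hext] at this
    have h1 : vtx a t ∈ st a (s + 1) :=
      survivors_subset hsub hcard he (Nat.succ_le_of_lt hst)
        (fun s hs => hA a haA s (by omega)) (hmem t)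
    have h2 : st a (s + 1) = nxt (st a s) (vtx a s) := by
      simp only [st, vtx, survivors, hext]
    rw [h2] at h1
    have h3 := (hprop _ _ (hmem s)).2.2 _ h1
    rwa [congrFun haw s, hs] at h3
  have hclique : ∀ a ∈ F, T.image (vtx a) ∈ K := by
    intro a ha
    have hadj' : ∀ s ∈ T, ∀ t ∈ T, s ≠ t → (C.labelGraph i).Adj (vtx a s) (vtx a t) := by
      intro s hs t ht hst
      rcases lt_or_gt_of_ne hst with h | h
      · exact hadj a ha s t h (hT s hs)
      · exact (hadj a ha t s h (hT t ht)).symm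
    refine mem_filter.2 ⟨mem_univ _, i, ?_, ?_⟩
    · intro x hx y hy hxy
      obtain ⟨s, hs, rfl⟩ := mem_image.1 (mem_coe.1 hx)
      obtain ⟨t, ht, rfl⟩ := mem_image.1 (mem_coe.1 hy)
      exact hadj' s hs t ht fun h => hxy (by rw [h])
    · refine card_image_of_injOn fun s hs t ht hst => ?_
      by_contra hne
      exact (hadj' s hs t ht hne).ne hst
  have hfib : ∀ s ∈ K, (F.filter fun a => T.image (vtx a) = s).card ≤
      T.card ^ T.card * ∏ t ∈ Tᶜ, (n / 2 ^ (t : ℕ)) := by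
    intro s hs
    obtain ⟨-, j, hj⟩ := mem_filter.1 hs
    let code : (Fin m → ℕ) → Fin m → (Fin n ⊕ ℕ) := fun a t =>
      if t ∈ T then Sum.inl (vtx a t) else Sum.inr (a t)
    let P : Finset (Fin m → (Fin n ⊕ ℕ)) := Fintype.piFinset fun t =>
      if t ∈ T then s.image Sum.inl else (range (n / 2 ^ (t : ℕ))).image Sum.inr
    have hP : P.card = T.card ^ T.card * ∏ t ∈ Tᶜ, (n / 2 ^ (t : ℕ)) := by
      rw [Fintype.card_piFinset, ← prod_mul_prod_compl T]
      congr 1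
      · rw [← prod_const]
        refine prod_congr rfl fun t ht => ?_
        rw [if_pos ht, card_image_of_injective _ Sum.inl_injective, hj.card_eq]
      · refine prod_congr rfl fun t ht => ?_
        rw [if_neg (mem_compl.1 ht), card_image_of_injective _ Sum.inr_injective, card_range]
    rw [← hP]
    refine card_le_card_of_injOn code ?_ ?_
    · intro a ha
      obtain ⟨haF, has⟩ := mem_filter.1 (mem_coe.1 ha)
      refine mem_coe.2 (Fintype.mem_piFinset.2 fun t => ?_)
      by_cases ht : t ∈ T
      · simp only [code, ht, if_true]
        exact mem_image_of_mem _ (has ▸ mem_image_of_mem _ ht)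
      · simp only [code, ht, if_false]
        exact mem_image_of_mem _ (Fintype.mem_piFinset.1 (mem_filter.1 haF).1 t)
    · intro a ha a' ha' hcode
      have haA := (mem_filter.1 (mem_filter.1 (mem_coe.1 ha)).1).1
      have haA' := (mem_filter.1 (mem_filter.1 (mem_coe.1 ha')).1).1
      have := (survivors_code_unique (nxt := nxt) hcard he hinj (hA a haA) (hA a' haA')
        (fun s hs => by
          have h := congrFun hcode ⟨s, hs⟩
          have h1 := hext a ⟨s, hs⟩
          have h2 := hext a' ⟨s, hs⟩
          simp only at h1 h2
          rw [h1, h2]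
          by_cases ht : (⟨s, hs⟩ : Fin m) ∈ T
          · simp only [code, ht, if_true] at h
            exact Or.inr (Sum.inl_injective h)
          · simp only [code, ht, if_false] at h
            exact Or.inl (Sum.inr_injective h)) le_rfl).2
      funext t
      rw [← hext a t, ← hext a' t]
      exact this t t.2
  have h1 : F.card ≤ (T.card ^ T.card * ∏ t ∈ Tᶜ, (n / 2 ^ (t : ℕ))) * K.card :=
    card_le_mul_card_image_of_maps_to hclique _ hfib
  have h2 : A.card ≤ F.card * 2 ^ m := by
    rw [div_le_iff₀ (by positivity)] at hw
    exact_mod_cast hw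
  rw [hAcard, ← prod_mul_prod_compl T] at h2
  refine Nat.le_of_mul_le_mul_right (c := ∏ t ∈ Tᶜ, (n / 2 ^ (t : ℕ))) ?_
    (prod_pos fun t _ => hx t)
  calc _ ≤ F.card * 2 ^ m := h2
    _ ≤ ((T.card ^ T.card * ∏ t ∈ Tᶜ, (n / 2 ^ (t : ℕ))) * K.card) * 2 ^ m :=
      Nat.mul_le_mul_right _ h1
    _ = _ := by rw [hK]; ring

/-! ### Choosing the positions -/

/-- The sum of `q` distinct natural numbers is at least `0 + 1 + ... + (q - 1)`. -/
theorem card_mul_card_sub_one_le_two_mul_sum {m : ℕ} (T : Finset (Fin m)) :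
    T.card * (T.card - 1) ≤ 2 * ∑ t ∈ T, (t : ℕ) := by
  have h : ∑ i : Fin T.card, (i : ℕ) ≤ ∑ i : Fin T.card, (T.orderEmbOfFin rfl i : ℕ) := by
    refine Finset.sum_le_sum fun i _ => ?_
    -- Continuing by `m + j` keeps the enumeration strictly increasing on all of `ℕ`.
    exact_mod_cast (StrictMono.le_apply (f := fun j : ℕ =>
      if h : j < T.card then (T.orderEmbOfFin rfl ⟨j, h⟩ : ℕ) else m + j) (x := (i : ℕ)) (by
        intro a b hab
        dsimp only
        split_ifs with h1 h2
        · exact (T.orderEmbOfFin rfl).strictMono (by simpa using hab)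
        · omega
        · omega
        · omega)).trans (by simp)
  have h2 : ∑ i : Fin T.card, (T.orderEmbOfFin rfl i : ℕ) = ∑ t ∈ T, (t : ℕ) := by
    conv_rhs => rw [← Finset.image_orderEmbOfFin_univ T rfl]
    rw [Finset.sum_image fun a _ b _ h => (T.orderEmbOfFin rfl).injective h]
  rw [← h2, ← Finset.sum_range_id_mul_two, ← Fin.sum_univ_eq_sum_range (fun i => i)]
  omega

open Finset in
/-- A binary word of length `⌊10b/7⌋` has a monochromatic set `T` of positions, of size between
`3b/7` and `b`, whose positions add up to at most `|T| ^ 2`. -/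
theorem exists_monochromatic_positions {b m : ℕ} (hb : 14 ≤ b) (hm : m = 10 * b / 7)
    (w : Fin m → Fin 2) : ∃ (i : Fin 2) (T : Finset (Fin m)), (∀ t ∈ T, w t = i) ∧
      3 * b < 7 * T.card ∧ T.card < b ∧ ∑ t ∈ T, (t : ℕ) ≤ T.card ^ 2 := by
  classical
  have htot : 2 * ∑ t : Fin m, (t : ℕ) = m * (m - 1) := by
    rw [Fin.sum_univ_eq_sum_range (fun i => i), mul_comm, sum_range_id_mul_two]
  by_cases hbig : ∃ i, b ≤ (univ.filter fun t => w t = i).card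
  · obtain ⟨i, hi⟩ := hbig
    obtain ⟨T, hT, hTc⟩ := exists_subset_card_eq ((Nat.sub_le b 1).trans hi)
    refine ⟨i, T, fun t ht => (mem_filter.1 (hT ht)).2, by omega, by omega, ?_⟩
    -- The sum over `T` is the total minus that over `Tᶜ`, so a lower bound on the latter suffices.
    have h1 := card_mul_card_sub_one_le_two_mul_sum Tᶜ
    have h2 := sum_add_sum_compl T fun t : Fin m => (t : ℕ)
    have h3 : Tᶜ.card = m - (b - 1) := by rw [card_compl, hTc, Fintype.card_fin]
    rw [h3] at h1
    rw [hTc]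
    obtain ⟨k, rfl⟩ : ∃ k, b = k + 1 := ⟨b - 1, by omega⟩
    obtain ⟨q, hq⟩ : ∃ q, m = k + (q + 1) := ⟨m - k - 1, by omega⟩
    -- This is where `14 ≤ b` is needed.
    have h4 : 2 * m ≤ 3 * k + 1 := by omega
    rw [show m - (k + 1 - 1) = q + 1 by omega] at h1
    have h6 : m * (m - 1) = (k + (q + 1)) * (k + q) := by
      rw [show m - 1 = k + q by omega, ← hq]
    simp only [Nat.add_sub_cancel] at h1 ⊢
    have h5 : k * (2 * q + 1) ≤ k * k := Nat.mul_le_mul_left k (by omega)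
    rw [h6, ← h2] at htot
    generalize ∑ t ∈ T, (t : ℕ) = x at *
    generalize ∑ t ∈ Tᶜ, (t : ℕ) = y at *
    nlinarith
  · push Not at hbig
    set R := univ.filter fun t => w t = 0 with hR
    have hRc : Rᶜ = univ.filter fun t => w t = 1 := by
      have h01 : ∀ x : Fin 2, ¬ x = 0 ↔ x = 1 := by decide
      ext t
      simp [hR, h01]
    have hr : R.card < b := hbig 0
    have hs := hbig 1
    rw [← hRc] at hs
    have hsum : R.card + Rᶜ.card = m := by rw [card_add_card_compl, Fintype.card_fin]
    have h2 := sum_add_sum_compl R fun t : Fin m => (t : ℕ)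
    -- Hence the two position sums total at most `|R|² + |Rᶜ|²`, and one colour meets its bound.
    have h3 : m * (m - 1) ≤ 2 * (R.card ^ 2 + Rᶜ.card ^ 2) := by
      have hsq : m * m = (R.card + Rᶜ.card) ^ 2 := by rw [hsum, sq]
      refine (Nat.mul_le_mul_left m (Nat.sub_le m 1)).trans (hsq.le.trans add_sq_le)
    rw [← htot, ← h2] at h3
    rcases le_or_gt (∑ t ∈ R, (t : ℕ)) (R.card ^ 2) with h | h
    · exact ⟨0, R, fun t ht => (mem_filter.1 ht).2, by omega, hr, h⟩
    · exact ⟨1, Rᶜ, fun t ht => by rw [hRc] at ht; exact (mem_filter.1 ht).2, by omega, hs, by omega⟩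

/-! ### Estimates and conclusion -/

theorem eventually_add_logb_le_mul {ε : ℝ} (hε : 0 < ε) (d : ℝ) :
    ∀ᶠ k : ℕ in Filter.atTop, d + Real.logb 2 (k : ℝ) ≤ ε * (k : ℝ) := by
  have hl2 : 0 < Real.log 2 := Real.log_pos one_lt_two
  have h1 := (Real.isLittleO_log_id_atTop.comp_tendsto tendsto_natCast_atTop_atTop).def
    (show 0 < ε / 2 * Real.log 2 by positivity)
  have h2 := (tendsto_natCast_atTop_atTop (R := ℝ)).eventually_ge_atTop (2 * d / ε)
  filter_upwards [h1, h2] with k hk hk2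
  simp only [Function.comp, id, Real.norm_eq_abs, Nat.abs_cast] at hk
  have h3 : Real.logb 2 (k : ℝ) ≤ ε / 2 * k := by
    rw [Real.logb, div_le_iff₀ hl2]
    linarith [le_abs_self (Real.log (k : ℝ))]
  rw [div_le_iff₀ hε] at hk2
  linarith

-- Each quotient is at least 1, so rounding down loses at most a factor 2 per position.
open Finset in
theorem pow_le_two_pow_mul_prod_div {n m : ℕ} (hm : 2 ^ m ≤ n) (T : Finset (Fin m)) :
    (n : ℝ) ^ T.card ≤
      2 ^ (T.card + ∑ t ∈ T, (t : ℕ)) * ∏ t ∈ T, ((n / 2 ^ (t : ℕ) : ℕ) : ℝ) := by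
  have h : ∀ t ∈ T, (n : ℝ) ≤ 2 * 2 ^ (t : ℕ) * ((n / 2 ^ (t : ℕ) : ℕ) : ℝ) := by
    intro t _
    have hpos : 0 < n / 2 ^ (t : ℕ) :=
      Nat.div_pos ((Nat.pow_le_pow_right two_pos t.2.le).trans hm) (by positivity)
    have h1 := Nat.lt_mul_div_succ n (show 0 < 2 ^ (t : ℕ) by positivity)
    have h2 : n ≤ 2 * 2 ^ (t : ℕ) * (n / 2 ^ (t : ℕ)) := by nlinarith
    exact_mod_cast h2
  calc (n : ℝ) ^ T.card = ∏ _t ∈ T, (n : ℝ) := by rw [prod_const]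
    _ ≤ ∏ t ∈ T, (2 * 2 ^ (t : ℕ) * ((n / 2 ^ (t : ℕ) : ℕ) : ℝ)) :=
      prod_le_prod (fun _ _ => Nat.cast_nonneg n) h
    _ = _ := by
      rw [prod_mul_distrib, prod_mul_distrib, prod_const, prod_pow_eq_pow_sum, ← pow_add]

theorem mainTheorem7 (ε : ℝ) (hε : 0 < ε) :
    ∃ c : ℕ, ∀ n b : ℕ, c ≤ b → (b : ℝ) ≤ (7 / 10 : ℝ) * Real.logb 2 (n : ℝ) →
      ∀ C : SimpleGraph.TopEdgeLabeling (Fin n) (Fin 2),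
        ∃ k : ℕ, (3 / 7 : ℝ) * (b : ℝ) < (k : ℝ) ∧ k < b ∧
          (n : ℝ) ^ k / (2 : ℝ) ^ ((1 + ε) * (k : ℝ) ^ 2) ≤ (numMonoCliques C k : ℝ) := by
  -- The 5 covers the error `k + m ≤ 5k` in the exponent; `k > 3b/7` makes `b ≥ 3k₀` enough for `k ≥
  -- k₀`.
  obtain ⟨k₀, hk₀⟩ := Filter.eventually_atTop.1 (eventually_add_logb_le_mul hε 5)
  refine ⟨3 * k₀ + 14, fun n b hcb hbn C => ?_⟩
  set m := 10 * b / 7 with hm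
  have hn : 0 < n := by
    rcases Nat.eq_zero_or_pos n with rfl | h
    · have : (14 : ℝ) ≤ b := by exact_mod_cast (by omega : 14 ≤ b)
      simp at hbn
      linarith
    · exact h
  have hmn : 2 ^ m ≤ n := by
    have h7 : 7 * (m : ℝ) ≤ 10 * b := by exact_mod_cast (by omega : 7 * m ≤ 10 * b)
    have h1 : (m : ℝ) ≤ Real.logb 2 n := by linarith
    rw [Real.le_logb_iff_rpow_le one_lt_two (by exact_mod_cast hn), Real.rpow_natCast] at h1
    exact_mod_cast h1
  obtain ⟨w, hw⟩ := exists_pattern_prod_le_numMonoCliques hmn C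
  obtain ⟨i, T, hT, hlo, hhi, hsum⟩ := exists_monochromatic_positions (by omega) hm w
  have hcount := hw i T hT
  have hpow := pow_le_two_pow_mul_prod_div hmn T
  set k := T.card with hk
  refine ⟨k, ?_, hhi, ?_⟩
  · have : (3 : ℝ) * b < 7 * k := by exact_mod_cast hlo
    linarith
  have hkpos : (0 : ℝ) < k := by exact_mod_cast (by omega : 0 < k)
  have hkk : (2 : ℝ) ^ ((k : ℝ) * Real.logb 2 k) = (k : ℝ) ^ k := by
    rw [mul_comm, Real.rpow_mul zero_le_two, Real.rpow_logb two_pos (by norm_num) hkpos,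
      Real.rpow_natCast]
  have hexp : (2 : ℝ) ^ (k + k ^ 2 + m) * (k : ℝ) ^ k ≤ 2 ^ ((1 + ε) * (k : ℝ) ^ 2) := by
    rw [← hkk, ← Real.rpow_natCast, ← Real.rpow_add two_pos]
    refine Real.rpow_le_rpow_of_exponent_le one_le_two ?_
    have h1 := mul_le_mul_of_nonneg_left (hk₀ k (by omega)) hkpos.le
    have h2 : (m : ℝ) ≤ 4 * k := by exact_mod_cast (by omega : m ≤ 4 * k)
    push_cast
    linarith
  rw [div_le_iff₀ (by positivity)]
  have hcount' : ∏ t ∈ T, ((n / 2 ^ (t : ℕ) : ℕ) : ℝ) ≤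
      2 ^ m * ((k : ℝ) ^ k * numMonoCliques C k) := by exact_mod_cast hcount
  calc (n : ℝ) ^ k ≤ 2 ^ (k + ∑ t ∈ T, (t : ℕ)) * ∏ t ∈ T, ((n / 2 ^ (t : ℕ) : ℕ) : ℝ) := hpow
    _ ≤ 2 ^ (k + k ^ 2) * (2 ^ m * ((k : ℝ) ^ k * numMonoCliques C k)) := by
      refine mul_le_mul (pow_le_pow_right₀ one_le_two (by omega)) hcount' ?_ (by positivity)
      exact Finset.prod_nonneg fun _ _ => Nat.cast_nonneg _
    _ = numMonoCliques C k * (2 ^ (k + k ^ 2 + m) * (k : ℝ) ^ k) := by ring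
    _ ≤ numMonoCliques C k * 2 ^ ((1 + ε) * (k : ℝ) ^ 2) :=
      mul_le_mul_of_nonneg_left hexp (Nat.cast_nonneg _)
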